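/- Let $V$ be a separable right quaternionic Hilbert space (a right vector space over the quaternions $\mathbb H$, complete and separable for the norm $\|\phi\|^2=\langle\phi\mid\phi\rangle$ of an $\mathbb H$-valued inner product that is additive and right $\mathbb H$-linear in the second variable and satisfies $\overline{\langle\phi\mid\psi\rangle}=\langle\psi\mid\phi\rangle$). Let $\mathcal B(V)$ be the real unital algebra of bounded right $\mathbb H$-linear operators $V\to V$ and $\mathcal B_0(V)$ its two-sided ideal of compact operators. For an element $a$ of a real unital algebra $R$ and $q\in\mathbb H$ put $R_q(a)=a^2-2\,\mathrm{Re}(q)\,a+|q|^2\,1$, and let $\sigma_S(a)=\{q\in\mathbb H : R_q(a)\text{ has no two-sided inverse in }R\}$ be the S-spectrum of $a$. An operator $T\in\mathcal B(V)$ is Fredholm if $\ker T$ and $V/\operatorname{ran}T$ are finite-dimensional over $\mathbb H$; its index is then $\operatorname{ind}T=\dim_{\mathbb H}\ker T-\dim_{\mathbb H}(V/\operatorname{ran}T)$. For $A\in\mathcal B(V)$ define: - the essential S-spectrum $\sigma_e^S(A)=\sigma_S(\pi(A))$, where $\pi:\mathcal B(V)\to\mathcal B(V)/\mathcal B_0(V)$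 is the quotient map onto the Calkin algebra; - for $k\in\mathbb Z\setminus\{0\}$, $\sigma_k^S(A)=\{q\in\mathbb H : R_q(A)\text{ is Fredholm and }\operatorname{ind}R_q(A)=k\}$; - $\sigma_0^S(A)=\{q\in\sigma_S(A) : R_q(A)\text{ is Fredholm and }\operatorname{ind}R_q(A)=0\}$; - the Weyl S-spectrum $\omega_S(A)=\bigcap_{K\in\mathcal B_0(V)}\sigma_S(A+K)$. Then for every $A\in\mathcal B(V)$, $$\omega_S(A)=\sigma_e^S(A)\cup\bigcup_{k\in\mathbb Z\setminus\{0\}}\sigma_k^S(A)=\sigma_S(A)\setminus\sigma_0^S(A).$$ -/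

import Mathlib

open scoped Quaternion MulOpposite

noncomputable section

/-- A right quaternionic inner product on a right `ℍ`-module `V` (right multiplication `φ q` is
`MulOpposite.op q • φ`), whose associated norm is the norm of `V`. A right quaternionic Hilbert
space is such a `V` that is moreover complete (and, here, separable). -/
class RightQuaternionicInnerProductSpace (V : Type*) [NormedAddCommGroup V]
    [Module ℍ[ℝ]ᵐᵒᵖ V] extends Inner ℍ[ℝ] V where
  star_inner : ∀ φ ψ : V, star (inner φ ψ) = inner ψ φ
  inner_self : ∀ φ : V, inner φ φ = ((‖φ‖ ^ 2 : ℝ) : ℍ[ℝ])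
  inner_add_right : ∀ φ ψ ω : V, inner φ (ψ + ω) = inner φ ψ + inner φ ω
  inner_smul_right : ∀ (φ ψ : V) (q : ℍ[ℝ]), inner φ (MulOpposite.op q • ψ) = inner φ ψ * q

namespace RightQuaternionicInnerProductSpace

variable {V : Type*} [NormedAddCommGroup V] [Module ℍ[ℝ]ᵐᵒᵖ V]
  [RightQuaternionicInnerProductSpace V]

theorem inner_smul_left (φ ψ : V) (q : ℍ[ℝ]) :
    inner ℍ[ℝ] (MulOpposite.op q • φ) ψ = star q * inner ℍ[ℝ] φ ψ := by
  rw [← star_inner, inner_smul_right, star_mul, star_inner]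

theorem norm_smul_right (φ : V) (q : ℍ[ℝ]) : ‖MulOpposite.op q • φ‖ = ‖q‖ * ‖φ‖ := by
  have h : ((‖MulOpposite.op q • φ‖ ^ 2 : ℝ) : ℍ[ℝ]) = (((‖q‖ * ‖φ‖) ^ 2 : ℝ) : ℍ[ℝ]) := by
    rw [← inner_self, inner_smul_right, inner_smul_left, inner_self,
      ← Quaternion.coe_commutes, mul_assoc, Quaternion.star_mul_self,
      Quaternion.normSq_eq_norm_mul_self, ← Quaternion.coe_mul]
    congr 1
    ring
  have h' := Quaternion.coe_injective h
  exact (pow_left_inj₀ (norm_nonneg _) (by positivity) two_ne_zero).1 h'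

/-- Multiplication by a real number `r`, which is right multiplication by the quaternion `r`. -/
instance (priority := 900) instNormedSpaceReal : NormedSpace ℝ V where
  toModule := Module.compHom V (algebraMap ℝ ℍ[ℝ]ᵐᵒᵖ)
  norm_smul_le r φ := by
    have h := norm_smul_right φ (r : ℍ[ℝ])
    rw [Quaternion.norm_coe] at h
    exact h.le

instance (priority := 900) instIsScalarTower : IsScalarTower ℝ ℍ[ℝ]ᵐᵒᵖ V where
  smul_assoc r q φ := by
    change (r • q) • φ = (algebraMap ℝ ℍ[ℝ]ᵐᵒᵖ r) • (q • φ)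
    rw [Algebra.smul_def, mul_smul]

instance (priority := 900) instSMulCommClass : SMulCommClass ℍ[ℝ]ᵐᵒᵖ ℝ V where
  smul_comm q r φ := by
    change q • (algebraMap ℝ ℍ[ℝ]ᵐᵒᵖ r) • φ = (algebraMap ℝ ℍ[ℝ]ᵐᵒᵖ r) • (q • φ)
    rw [smul_smul, smul_smul, Algebra.commutes]

end RightQuaternionicInnerProductSpace

/-- `R_q(a) = a² - 2 Re(q) a + |q|² 1` in a real unital algebra. -/
def pseudoResolvent {R : Type*} [Ring R] [Algebra ℝ R] (q : ℍ[ℝ]) (a : R) : R :=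
  a ^ 2 - (2 * q.re) • a + (‖q‖ ^ 2) • (1 : R)

/-- The S-spectrum of an element of a real unital algebra: those quaternions `q` for which
`R_q(a)` has no (two-sided) inverse in the algebra. -/
def sSpectrum {R : Type*} [Ring R] [Algebra ℝ R] (a : R) : Set ℍ[ℝ] :=
  {q | ¬ IsUnit (pseudoResolvent q a)}

section Operators

variable {V : Type*} [NormedAddCommGroup V] [Module ℍ[ℝ]ᵐᵒᵖ V]

/-- Fredholm operators: finite-dimensional kernel and cokernel. -/
def IsFredholmOp (T : V →L[ℍ[ℝ]ᵐᵒᵖ] V) : Prop :=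
  Module.Finite ℍ[ℝ]ᵐᵒᵖ T.ker ∧ Module.Finite ℍ[ℝ]ᵐᵒᵖ (V ⧸ T.range)

/-- The index `dim ker T - dim coker T` (quaternionic dimensions), meaningful for Fredholm `T`. -/
def fredholmIndex (T : V →L[ℍ[ℝ]ᵐᵒᵖ] V) : ℤ :=
  (Module.finrank ℍ[ℝ]ᵐᵒᵖ T.ker : ℤ) - (Module.finrank ℍ[ℝ]ᵐᵒᵖ (V ⧸ T.range) : ℤ)

/-- Weyl operators: Fredholm operators of index zero. -/
def IsWeylOp (T : V →L[ℍ[ℝ]ᵐᵒᵖ] V) : Prop :=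
  IsFredholmOp T ∧ fredholmIndex T = 0

variable (V) in
/-- The two-sided ideal of compact operators in the ring of bounded right linear operators. -/
def compactIdeal : TwoSidedIdeal (V →L[ℍ[ℝ]ᵐᵒᵖ] V) :=
  TwoSidedIdeal.mk' {K | IsCompactOperator K}
    (by exact isCompactOperator_zero)
    (by intro x y hx hy; exact IsCompactOperator.add hx hy)
    (by intro x hx; exact IsCompactOperator.neg hx)
    (by intro x y hy; exact IsCompactOperator.clm_comp hy x)
    (by intro x y hx; exact IsCompactOperator.comp_clm hx y)

theorem mem_compactIdeal {K : V →L[ℍ[ℝ]ᵐᵒᵖ] V} :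
    K ∈ compactIdeal V ↔ IsCompactOperator K :=
  TwoSidedIdeal.mem_mk' _ _ _ _ _ _ K

variable (V) in
/-- The quaternionic Calkin algebra: bounded operators modulo compact operators. -/
abbrev CalkinAlgebra : Type _ := (compactIdeal V).ringCon.Quotient

/-- The class of an operator in the Calkin algebra. -/
def toCalkin (T : V →L[ℍ[ℝ]ᵐᵒᵖ] V) : CalkinAlgebra V := (compactIdeal V).ringCon.mk' T

variable [RightQuaternionicInnerProductSpace V]

/-- The essential S-spectrum: the S-spectrum of the class of `A` in the Calkin algebra. -/
def essentialSSpectrum (A : V →L[ℍ[ℝ]ᵐᵒᵖ] V) : Set ℍ[ℝ] :=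
  sSpectrum (toCalkin A)

/-- For `k ≠ 0`: the set of `q` such that `R_q(A)` is Fredholm of index `k`. -/
def indexSSpectrum (k : ℤ) (A : V →L[ℍ[ℝ]ᵐᵒᵖ] V) : Set ℍ[ℝ] :=
  {q | IsFredholmOp (pseudoResolvent q A) ∧ fredholmIndex (pseudoResolvent q A) = k}

/-- The set of `q` in the S-spectrum of `A` such that `R_q(A)` is a Weyl operator. -/
def indexZeroSSpectrum (A : V →L[ℍ[ℝ]ᵐᵒᵖ] V) : Set ℍ[ℝ] :=
  {q | q ∈ sSpectrum A ∧ IsWeylOp (pseudoResolvent q A)}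

/-- The Weyl S-spectrum: the intersection of the S-spectra of all compact perturbations. -/
def weylSSpectrum (A : V →L[ℍ[ℝ]ᵐᵒᵖ] V) : Set ℍ[ℝ] :=
  ⋂ (K : V →L[ℍ[ℝ]ᵐᵒᵖ] V) (_ : IsCompactOperator K), sSpectrum (A + K)

end Operators

end

section RealFredholm

/-- A linear map with finite-dimensional kernel and cokernel, both of the same dimension. -/
def LinearMap.HasIndexZero {D V : Type*} [DivisionRing D] [AddCommGroup V] [Module D V]
    (f : V →ₗ[D] V) : Prop :=
  Module.Finite D (LinearMap.ker f) ∧ Module.Finite D (V ⧸ LinearMap.range f) ∧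
    Module.finrank D (LinearMap.ker f) = Module.finrank D (V ⧸ LinearMap.range f)

theorem LinearMap.hasIndexZero_of_bijective {D V : Type*} [DivisionRing D] [AddCommGroup V]
    [Module D V] {f : V →ₗ[D] V} (hf : Function.Bijective f) : f.HasIndexZero := by
  have h1 : LinearMap.ker f = ⊥ := LinearMap.ker_eq_bot.2 hf.1
  have h2 : LinearMap.range f = ⊤ := LinearMap.range_eq_top.2 hf.2
  have : Subsingleton (V ⧸ LinearMap.range f) := Submodule.Quotient.subsingleton_iff.2 h2
  refine ⟨by rw [h1]; infer_instance, inferInstance, ?_⟩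
  rw [h1, finrank_bot, Module.finrank_zero_of_subsingleton]

theorem LinearMap.HasIndexZero.bijective_of_injective {D V : Type*} [DivisionRing D]
    [AddCommGroup V] [Module D V] {f : V →ₗ[D] V} (h : f.HasIndexZero)
    (hf : Function.Injective f) : Function.Bijective f := by
  obtain ⟨_, _, h3⟩ := h
  rw [LinearMap.ker_eq_bot.2 hf, finrank_bot, eq_comm, Module.finrank_zero_iff] at h3
  exact ⟨hf, LinearMap.range_eq_top.1 (Submodule.Quotient.subsingleton_iff.1 h3)⟩

theorem LinearMap.HasIndexZero.bijective_of_surjective {D V : Type*} [DivisionRing D]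
    [AddCommGroup V] [Module D V] {f : V →ₗ[D] V} (h : f.HasIndexZero)
    (hf : Function.Surjective f) : Function.Bijective f := by
  obtain ⟨_, _, h3⟩ := h
  have : Subsingleton (V ⧸ LinearMap.range f) :=
    Submodule.Quotient.subsingleton_iff.2 (LinearMap.range_eq_top.2 hf)
  rw [Module.finrank_zero_of_subsingleton (M := V ⧸ LinearMap.range f),
    Module.finrank_zero_iff] at h3
  exact ⟨LinearMap.ker_eq_bot.1 (Submodule.eq_bot_of_subsingleton), hf⟩

theorem LinearMap.HasIndexZero.equiv_comp {D V : Type*} [DivisionRing D]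
    [AddCommGroup V] [Module D V] {f : V →ₗ[D] V} (h : f.HasIndexZero) (e : V ≃ₗ[D] V) :
    LinearMap.HasIndexZero ((e : V →ₗ[D] V) ∘ₗ f) := by
  have hk : LinearMap.ker ((e : V →ₗ[D] V) ∘ₗ f) = LinearMap.ker f := by
    ext x; simp
  have hr : (LinearMap.range f).map (e : V →ₗ[D] V) = LinearMap.range ((e : V →ₗ[D] V) ∘ₗ f) := by
    rw [LinearMap.range_comp]
  have eq := Submodule.Quotient.equiv _ _ e hr
  obtain ⟨h1, h2, h3⟩ := h
  refine ⟨by rw [hk]; exact h1, Module.Finite.equiv eq, ?_⟩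
  rw [hk, h3, eq.finrank_eq]

variable {E : Type*} [NormedAddCommGroup E] [NormedSpace ℝ E]

theorem isCompactOperator_of_finiteDimensional_factor {F : Type*} [NormedAddCommGroup F]
    [NormedSpace ℝ F] [FiniteDimensional ℝ F] (g : F →L[ℝ] E) (f : E →L[ℝ] F) :
    IsCompactOperator (g ∘L f) := by
  have : IsCompactOperator (id : F → F) := isCompactOperator_id_iff_finiteDimensional.2 ‹_›
  exact (this.comp_clm f).clm_comp g

theorem finiteDimensional_ker_one_add {K : E →L[ℝ] E} (hK : IsCompactOperator K) :
    FiniteDimensional ℝ (1 + K).ker := by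
  have hx (x : (1 + K).ker) : K x = -(x : E) := by
    have : (x : E) + K x = 0 := x.2
    exact (neg_eq_of_add_eq_zero_right this).symm
  have hmem (x : (1 + K).ker) : K x ∈ (1 + K).ker := by
    rw [hx]
    exact neg_mem x.2
  have h1 : IsCompactOperator fun x : (1 + K).ker => (⟨K x, hmem x⟩ : (1 + K).ker) :=
    (hK.comp_clm (1 + K).ker.subtypeL).codRestrict hmem (1 + K).isClosed_ker
  have h2 : (id : (1 + K).ker → (1 + K).ker) = -fun x => ⟨K x, hmem x⟩ := by
    funext x
    refine Subtype.ext ?_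
    change (x : E) = -K x
    rw [hx, neg_neg]
  have h3 : IsCompactOperator (id : (1 + K).ker → (1 + K).ker) := by
    rw [h2]
    exact h1.neg
  exact FiniteDimensional.of_isCompactOperator_id (𝕜 := ℝ) h3

variable [CompleteSpace E]

theorem exists_parametrix (T : E →L[ℝ] E)
    (hr : FiniteDimensional ℝ (E ⧸ T.range)) (P : E →L[ℝ] T.ker) (hP : ∀ x : T.ker, P x = x) :
    ∃ S F : E →L[ℝ] E, IsCompactOperator F ∧ (∀ x, T (S x) + F x = x) ∧
      (∀ x, S (T x) + P x = x) ∧ ∀ x, F (T x) = 0 := by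
  obtain ⟨C, hC⟩ := Submodule.exists_isCompl T.range
  have : FiniteDimensional ℝ C := (Submodule.quotientEquivOfIsCompl _ _ hC).finiteDimensional
  have : CompleteSpace P.ker := P.isClosed_ker.completeSpace_coe
  let φ : (P.ker × C) →L[ℝ] E := (T ∘L P.ker.subtypeL).coprod C.subtypeL
  have hφ (m : P.ker) (c : C) : φ (m, c) = T m + c := by simp [φ]
  have hinj : φ.ker = ⊥ := by
    rw [Submodule.eq_bot_iff]
    rintro ⟨m, c⟩ h
    have h : T m + c = 0 := by rw [← hφ]; exact h
    have hc : (c : E) = 0 := by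
      refine Submodule.disjoint_def.1 hC.disjoint _ ?_ c.2
      rw [← neg_eq_of_add_eq_zero_right h]
      exact T.range.neg_mem ⟨m, rfl⟩
    have hm : (m : E) ∈ T.ker := by simpa [hc] using h
    have hm' := hP ⟨m, hm⟩
    rw [show P ((⟨m, hm⟩ : T.ker) : E) = 0 from m.2] at hm'
    have : (m : E) = 0 := (congrArg Subtype.val hm').symm
    ext <;> simp [this, hc]
  have hsurj : φ.range = ⊤ := by
    rw [eq_top_iff]
    intro v _
    obtain ⟨_, ⟨x, rfl⟩, c, hc, rfl⟩ := Submodule.mem_sup.1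
      (show v ∈ T.range ⊔ C by rw [hC.sup_eq_top]; trivial)
    refine ⟨(⟨x - P x, ?_⟩, ⟨c, hc⟩), ?_⟩
    · simp [hP]
    · have : T (P x) = 0 := (P x).2
      change φ _ = T x + c
      rw [hφ]
      simp [this]
  let e := ContinuousLinearEquiv.ofBijective φ hinj hsurj
  have he (y) : e y = φ y := rfl
  have key (x : E) : T ((e.symm x).1) + ((e.symm x).2 : E) = x := by
    rw [← hφ, ← he]; exact e.apply_symm_apply x
  have key2 (x : E) : e.symm (T x) = (⟨x - P x, by simp [hP]⟩, 0) := by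
    rw [e.symm_apply_eq, he, hφ]
    have : T (P x) = 0 := (P x).2
    simp [this]
  refine ⟨P.ker.subtypeL ∘L .fst ℝ P.ker C ∘L (e.symm : E →L[ℝ] P.ker × C), C.subtypeL ∘L (.snd ℝ P.ker C ∘L (e.symm : E →L[ℝ] P.ker × C)),
    isCompactOperator_of_finiteDimensional_factor _ _, fun x => key x, fun x => ?_, fun x => ?_⟩
  · simp [key2]
  · simp [key2]

theorem isClosed_range_of_finiteDimensional (T : E →L[ℝ] E) (hk : FiniteDimensional ℝ T.ker)
    (hr : FiniteDimensional ℝ (E ⧸ T.range)) : IsClosed (T.range : Set E) := by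
  obtain ⟨P, hP⟩ := Submodule.ClosedComplemented.of_finiteDimensional T.ker
  obtain ⟨S, F, -, h1, -, h3⟩ := exists_parametrix T hr P hP
  have : (T.range : Set E) = F.ker := by
    ext v
    refine ⟨?_, fun h => ⟨S v, ?_⟩⟩
    · rintro ⟨x, rfl⟩; exact h3 x
    · have h' : F v = 0 := h
      simpa [h'] using h1 v
  rw [this]
  exact F.isClosed_ker

theorem bijective_one_add_of_injective {K : E →L[ℝ] E} (hK : IsCompactOperator K)
    (h : Function.Injective (1 + K : E →L[ℝ] E)) : Function.Bijective (1 + K : E →L[ℝ] E) := by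
  rcases hK.hasEigenvalue_or_mem_resolventSet (μ := -1) (by norm_num) with h1 | h1
  · obtain ⟨v, hv⟩ := h1.exists_hasEigenvector
    refine absurd (h (a₁ := v) (a₂ := 0) ?_) hv.2
    have := hv.apply_eq_smul
    simp at this
    simp [this]
  · rw [spectrum.mem_resolventSet_iff, ← IsUnit.neg_iff] at h1
    rw [← ContinuousLinearMap.isUnit_iff_bijective]
    convert h1 using 1
    simp [add_comm]

theorem bijective_one_add_of_surjective {K : E →L[ℝ] E} (hK : IsCompactOperator K)
    (hk : FiniteDimensional ℝ (1 + K).ker)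
    (h : Function.Surjective (1 + K : E →L[ℝ] E)) : Function.Bijective (1 + K : E →L[ℝ] E) := by
  obtain ⟨P, hP⟩ := Submodule.ClosedComplemented.of_finiteDimensional (1 + K).ker
  have hr : Subsingleton (E ⧸ (1 + K).range) :=
    Submodule.Quotient.subsingleton_iff.2 (LinearMap.range_eq_top.2 h)
  obtain ⟨S, F, -, h1, -, h3⟩ := exists_parametrix (1 + K) inferInstance P hP
  have hF (x) : F x = 0 := by obtain ⟨y, rfl⟩ := h x; exact h3 y
  have hTS (x) : (1 + K) (S x) = x := by simpa [hF] using h1 x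
  have hS : S = 1 + -(K ∘L S) := by
    ext x
    have := hTS x
    simp at this
    simp [← sub_eq_add_neg, eq_sub_iff_add_eq, this]
  have hSb : Function.Bijective S := by
    rw [hS]
    refine bijective_one_add_of_injective (hK.comp_clm S).neg ?_
    rw [← hS]
    exact Function.LeftInverse.injective hTS
  refine ⟨fun x y hxy => ?_, h⟩
  obtain ⟨x, rfl⟩ := hSb.2 x
  obtain ⟨y, rfl⟩ := hSb.2 y
  rw [hTS, hTS] at hxy
  rw [hxy]

theorem hasIndexZero_one_add {K : E →L[ℝ] E} (hK : IsCompactOperator K) :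
    (1 + K).toLinearMap.HasIndexZero := by
  have hk := finiteDimensional_ker_one_add hK
  set T := 1 + K with hT
  obtain ⟨P, hP⟩ := Submodule.ClosedComplemented.of_finiteDimensional T.ker
  obtain ⟨C, hC⟩ := Submodule.exists_isCompl T.range
  have eC := Submodule.quotientEquivOfIsCompl _ _ hC
  have split (x : E) (c : C) (h : T x + c = 0) : T x = 0 ∧ c = 0 := by
    have hc : (c : E) = 0 := by
      refine Submodule.disjoint_def.1 hC.disjoint _ ?_ c.2
      rw [← neg_eq_of_add_eq_zero_right h]
      exact T.range.neg_mem ⟨x, rfl⟩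
    exact ⟨by simpa [hc] using h, by ext; exact hc⟩
  -- an injective map from the kernel to a complement of the range is surjective
  have hinj (g : T.ker →ₗ[ℝ] C) (hg : Function.Injective g) : Function.Surjective g := by
    let G : E →L[ℝ] E := (C.subtypeL ∘L LinearMap.toContinuousLinearMap g) ∘L P
    have hG : IsCompactOperator G := isCompactOperator_of_finiteDimensional_factor _ _
    have hGx (x : E) : G x = g (P x) := rfl
    have hKG : IsCompactOperator (K + G) := hK.add hG
    have hb := bijective_one_add_of_injective hKG (by
      rw [← add_assoc, ← hT]
      refine (injective_iff_map_eq_zero _).2 fun x hx => ?_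
      obtain ⟨h1, h2⟩ := split x (g (P x)) hx
      have h3 := hP ⟨x, h1⟩
      rw [hg (h2.trans (map_zero g).symm)] at h3
      exact (congrArg Subtype.val h3).symm)
    rw [← add_assoc, ← hT] at hb
    intro c
    obtain ⟨x, hx⟩ := hb.2 c
    have hx : T x + g (P x) = c := hx
    have := (split x (g (P x) - c) (by simp [← hx])).2
    exact ⟨P x, sub_eq_zero.1 this⟩
  have hsurj (g : T.ker →ₗ[ℝ] C) (hg : Function.Surjective g) : Function.Injective g := by
    let G : E →L[ℝ] E := (C.subtypeL ∘L LinearMap.toContinuousLinearMap g) ∘L P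
    have hG : IsCompactOperator G := isCompactOperator_of_finiteDimensional_factor _ _
    have hGx (x : E) : G x = g (P x) := rfl
    have hKG : IsCompactOperator (K + G) := hK.add hG
    have hb := bijective_one_add_of_surjective hKG (finiteDimensional_ker_one_add hKG) (by
      rw [← add_assoc, ← hT]
      intro v
      obtain ⟨_, ⟨x, rfl⟩, c, hc, rfl⟩ := Submodule.mem_sup.1
        (show v ∈ T.range ⊔ C by rw [hC.sup_eq_top]; trivial)
      obtain ⟨n, hn⟩ := hg ⟨c, hc⟩
      have h1 : T (P x) = 0 := (P x).2
      have h2 : T n = 0 := n.2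
      refine ⟨x - P x + n, ?_⟩
      change T (x - P x + n) + G (x - P x + n) = T x + c
      rw [hGx]
      simp [h1, h2, hP, hn])
    rw [← add_assoc, ← hT] at hb
    refine (injective_iff_map_eq_zero _).2 fun n hn => ?_
    have h2 : T n = 0 := n.2
    have : (T + G) n = (T + G) 0 := by
      simp [hGx, hP, hn, h2]
    exact Subtype.ext (hb.1 this)
  rcases le_total (Module.rank ℝ T.ker) (Module.rank ℝ C) with h | h
  · obtain ⟨g, hg⟩ := rank_le_iff_exists_linearMap.1 h
    have e := (LinearEquiv.ofBijective g ⟨hg, hinj g hg⟩).trans eC.symm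
    exact ⟨hk, e.finiteDimensional, e.finrank_eq⟩
  · obtain ⟨f, hf⟩ := rank_le_iff_exists_linearMap.1 h
    obtain ⟨g, hgf⟩ := f.exists_leftInverse_of_injective (LinearMap.ker_eq_bot.2 hf)
    have hg : Function.Surjective g := fun c => ⟨f c, LinearMap.congr_fun hgf c⟩
    have e := (LinearEquiv.ofBijective g ⟨hsurj g hg, hg⟩).trans eC.symm
    exact ⟨hk, e.finiteDimensional, e.finrank_eq⟩

theorem HasIndexZero.add_isCompactOperator {T K : E →L[ℝ] E} (hT : T.toLinearMap.HasIndexZero)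
    (hK : IsCompactOperator K) : (T + K).toLinearMap.HasIndexZero := by
  obtain ⟨hk, hr, hkr⟩ := hT
  obtain ⟨P, hP⟩ := Submodule.ClosedComplemented.of_finiteDimensional T.ker
  obtain ⟨C, hC⟩ := Submodule.exists_isCompl T.range
  have eC := Submodule.quotientEquivOfIsCompl _ _ hC
  have := eC.finiteDimensional
  let g : T.ker ≃ₗ[ℝ] C := LinearEquiv.ofFinrankEq _ _ (hkr.trans eC.finrank_eq)
  let G : E →L[ℝ] E := (C.subtypeL ∘L LinearMap.toContinuousLinearMap g.toLinearMap) ∘L P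
  have hG : IsCompactOperator G := isCompactOperator_of_finiteDimensional_factor _ _
  have hGx (x : E) : G x = g (P x) := rfl
  have hinj : Function.Injective (T + G) := by
    refine (injective_iff_map_eq_zero _).2 fun x hx => ?_
    have hx : T x + g (P x) = 0 := hx
    have hc : (g (P x) : E) = 0 := by
      refine Submodule.disjoint_def.1 hC.disjoint _ ?_ (g (P x)).2
      rw [← neg_eq_of_add_eq_zero_right hx]
      exact T.range.neg_mem ⟨x, rfl⟩
    have h1 : T x = 0 := by simpa [hc] using hx
    have h3 := hP ⟨x, h1⟩
    rw [g.injective ((Subtype.ext hc : g (P x) = 0).trans (map_zero g).symm)] at h3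
    exact (congrArg Subtype.val h3).symm
  have hsurj : Function.Surjective (T + G) := by
    intro v
    obtain ⟨_, ⟨x, rfl⟩, c, hc, rfl⟩ := Submodule.mem_sup.1
      (show v ∈ T.range ⊔ C by rw [hC.sup_eq_top]; trivial)
    have h1 : T (P x) = 0 := (P x).2
    have h2 : T (g.symm ⟨c, hc⟩) = 0 := (g.symm ⟨c, hc⟩).2
    refine ⟨x - P x + g.symm ⟨c, hc⟩, ?_⟩
    change T (x - P x + g.symm ⟨c, hc⟩) + G (x - P x + g.symm ⟨c, hc⟩) = T x + c
    rw [hGx]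
    simp [h1, h2, hP]
  let e := ContinuousLinearEquiv.ofBijective (T + G) (LinearMap.ker_eq_bot.2 hinj)
    (LinearMap.range_eq_top.2 hsurj)
  have hKG : IsCompactOperator (K - G) := hK.sub hG
  have hc : IsCompactOperator ((e.symm : E →L[ℝ] E) ∘L (K - G)) := hKG.clm_comp (e.symm : E →L[ℝ] E)
  convert (hasIndexZero_one_add hc).equiv_comp e.toLinearEquiv using 1
  ext x
  have he (y) : e y = T y + G y := rfl
  simp [he x]

end RealFredholm

section Perturbation

variable {E : Type*} [NormedAddCommGroup E] [InnerProductSpace ℝ E] [CompleteSpace E]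

/-- If `K` pairs `c ⟂ ran L` with `x` as a multiple of `⟪e, x⟫`, where `e ∈ ker L`, then small
multiples of `K` perturb `L` to an operator with a strictly smaller kernel. -/
theorem exists_finrank_ker_add_smul_lt (L K : E →L[ℝ] E) (hk : FiniteDimensional ℝ L.ker)
    (hr : FiniteDimensional ℝ (E ⧸ L.range)) {e c : E} (he : L e = 0) (he0 : e ≠ 0)
    (hc : ∀ x, inner ℝ c (L x) = 0) {a : ℝ} (ha : a ≠ 0)
    (hK : ∀ x, inner ℝ c (K x) = a * inner ℝ e x) :
    ∃ t : ℝ, Module.finrank ℝ (L + t • K).ker < Module.finrank ℝ L.ker := by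
  obtain ⟨S, F, -, -, hS, -⟩ := exists_parametrix L hr L.ker.orthogonalProjectionOnto
    (fun x => Submodule.orthogonalProjectionOnto_mem_subspace_eq_self x)
  set t : ℝ := (‖S‖ * ‖K‖ + 1)⁻¹ with ht
  have ht0 : 0 < t := by positivity
  have ht1 : t * (‖S‖ * ‖K‖) < 1 := by
    rw [ht, inv_mul_lt_one₀ (by positivity)]
    linarith
  refine ⟨t, ?_⟩
  let p : (L + t • K).ker →ₗ[ℝ] L.ker :=
    L.ker.orthogonalProjectionOnto.toLinearMap ∘ₗ (L + t • K).ker.subtype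
  have hpx (x : (L + t • K).ker) : p x = L.ker.orthogonalProjectionOnto (x : E) := rfl
  have hker (x : (L + t • K).ker) : L x + t • K x = 0 := x.2
  have hp : Function.Injective p := by
    refine (injective_iff_map_eq_zero _).2 fun x hx => ?_
    have h1 := hS x
    rw [← hpx, hx, eq_neg_of_add_eq_zero_left (hker x)] at h1
    have h2 : ‖(x : E)‖ ≤ t * (‖S‖ * ‖K‖) * ‖(x : E)‖ := by
      conv_lhs => rw [← h1]
      simp only [map_neg, map_smul, Submodule.coe_zero, add_zero, norm_neg, norm_smul,
        Real.norm_of_nonneg ht0.le]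
      have h3 := S.le_opNorm (K x)
      have h4 := mul_le_mul_of_nonneg_left (K.le_opNorm x) (norm_nonneg S)
      calc t * ‖S (K x)‖ ≤ t * (‖S‖ * (‖K‖ * ‖(x : E)‖)) := by gcongr; exact h3.trans h4
        _ = _ := by ring
    have h3 : ‖(x : E)‖ = 0 := by
      by_contra h
      have : 0 < ‖(x : E)‖ := lt_of_le_of_ne (norm_nonneg _) (Ne.symm h)
      nlinarith
    exact Subtype.ext (norm_eq_zero.1 h3)
  have : FiniteDimensional ℝ (L + t • K).ker := FiniteDimensional.of_injective p hp
  refine lt_of_le_of_ne (LinearMap.finrank_le_finrank_of_injective hp) fun heq => ?_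
  obtain ⟨x, hx⟩ := (LinearMap.injective_iff_surjective_of_finrank_eq_finrank heq).1 hp ⟨e, he⟩
  have h1 : inner ℝ e (x : E) = inner ℝ e e := by
    have := Submodule.inner_orthogonalProjectionOnto_eq_of_mem_right (K := L.ker) ⟨e, he⟩ (x : E)
    rw [← hpx, hx] at this
    rw [real_inner_comm]
    exact this.symm
  have h2 : inner ℝ c (L x + t • K x) = 0 := by rw [hker, inner_zero_right]
  rw [inner_add_right, hc, zero_add, inner_smul_right, hK, h1] at h2
  simp [ht0.ne', ha, he0] at h2

end Perturbation

section QuaternionicDimension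

theorem finrank_real_mulOpposite_quaternion : Module.finrank ℝ ℍ[ℝ]ᵐᵒᵖ = 4 := by
  rw [← (MulOpposite.opLinearEquiv ℝ : ℍ[ℝ] ≃ₗ[ℝ] ℍ[ℝ]ᵐᵒᵖ).finrank_eq]
  exact Quaternion.finrank_eq_four

instance : Module.Finite ℝ ℍ[ℝ]ᵐᵒᵖ :=
  Module.Finite.equiv (MulOpposite.opLinearEquiv ℝ : ℍ[ℝ] ≃ₗ[ℝ] ℍ[ℝ]ᵐᵒᵖ)

variable {W : Type*} [AddCommGroup W] [Module ℍ[ℝ]ᵐᵒᵖ W] [Module ℝ W] [IsScalarTower ℝ ℍ[ℝ]ᵐᵒᵖ W]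

theorem finite_real_iff_finite_quaternion :
    Module.Finite ℝ W ↔ Module.Finite ℍ[ℝ]ᵐᵒᵖ W :=
  ⟨fun _ => Module.Finite.of_restrictScalars_finite ℝ ℍ[ℝ]ᵐᵒᵖ W,
    fun _ => Module.Finite.trans ℍ[ℝ]ᵐᵒᵖ W⟩

theorem finrank_real_eq_four_mul : Module.finrank ℝ W = 4 * Module.finrank ℍ[ℝ]ᵐᵒᵖ W := by
  rw [← finrank_real_mulOpposite_quaternion, Module.finrank_mul_finrank]

end QuaternionicDimension

namespace RightQuaternionicInnerProductSpace

variable {V : Type*} [NormedAddCommGroup V] [Module ℍ[ℝ]ᵐᵒᵖ V]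
  [RightQuaternionicInnerProductSpace V]

theorem real_smul_def (r : ℝ) (x : V) : r • x = MulOpposite.op (r : ℍ[ℝ]) • x := rfl

theorem inner_add_left (x y z : V) : inner ℍ[ℝ] (x + y) z = inner ℍ[ℝ] x z + inner ℍ[ℝ] y z := by
  rw [← star_inner, inner_add_right, star_add, star_inner, star_inner]

variable (V) in
/-- The real part of the quaternionic inner product. -/
@[reducible] noncomputable def realInnerProductSpace : InnerProductSpace ℝ V where
  toNormedSpace := instNormedSpaceReal
  inner x y := (inner ℍ[ℝ] x y).re
  norm_sq_eq_re_inner x := by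
    rw [inner_self]
    exact (Quaternion.re_coe _).symm
  conj_inner_symm x y := by
    rw [← star_inner]
    simp
  add_left x y z := by simp [inner_add_left]
  smul_left x y r := by
    rw [real_smul_def, inner_smul_left]
    simp

/-- Right multiplication by a quaternion, as a bounded real-linear operator. -/
noncomputable def rightMul (q : ℍ[ℝ]) : V →L[ℝ] V :=
  LinearMap.mkContinuous
    { toFun := fun x => MulOpposite.op q • x
      map_add' := smul_add _
      map_smul' := fun r x => smul_comm _ r x } ‖q‖ fun x => (norm_smul_right x q).le

theorem rightMul_apply (q : ℍ[ℝ]) (x : V) : rightMul q x = MulOpposite.op q • x := rfl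

theorem norm_inner_le_norm (x y : V) : ‖inner ℍ[ℝ] x y‖ ≤ ‖x‖ * ‖y‖ := by
  let _ := realInnerProductSpace V
  set u := inner ℍ[ℝ] x y with hu
  rcases (norm_nonneg u).eq_or_lt with h0 | h0
  · rw [← h0]; positivity
  have h : ‖u‖ * ‖u‖ = inner ℝ x (MulOpposite.op (star u) • y) := by
    change _ = (inner ℍ[ℝ] x _).re
    rw [inner_smul_right, ← hu, Quaternion.self_mul_star, Quaternion.re_coe,
      Quaternion.normSq_eq_norm_mul_self]
  have h1 := h.le.trans (real_inner_le_norm _ _)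
  rw [norm_smul_right, norm_star] at h1
  nlinarith

/-- The functional `x ↦ ⟨e, x⟩`, as a bounded real-linear map. -/
noncomputable def innerRight (e : V) : V →L[ℝ] ℍ[ℝ] :=
  LinearMap.mkContinuous
    { toFun := fun x => inner ℍ[ℝ] e x
      map_add' := inner_add_right e
      map_smul' := fun r x => by
        rw [real_smul_def, inner_smul_right, ← Quaternion.coe_commutes, Quaternion.coe_mul_eq_smul]
        rfl } ‖e‖ (norm_inner_le_norm e)

/-- The map `q ↦ c q`, as a bounded real-linear map. -/
noncomputable def quaternionSMulRight (c : V) : ℍ[ℝ] →L[ℝ] V :=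
  LinearMap.toContinuousLinearMap
    { toFun := fun q => MulOpposite.op q • c
      map_add' := fun p q => by rw [MulOpposite.op_add, add_smul]
      map_smul' := fun r q => by rw [MulOpposite.op_smul, smul_assoc]; rfl }

/-- The bounded quaternionic linear operator `x ↦ c ⟨e, x⟩`. -/
noncomputable def rankOne (c e : V) : V →L[ℍ[ℝ]ᵐᵒᵖ] V where
  toFun x := MulOpposite.op (inner ℍ[ℝ] e x) • c
  map_add' x y := by rw [inner_add_right, MulOpposite.op_add, add_smul]
  map_smul' q x := by
    rw [← MulOpposite.op_unop q, inner_smul_right, MulOpposite.op_mul, mul_smul]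
    rfl
  cont := (quaternionSMulRight c ∘L innerRight e).continuous

theorem rankOne_apply (c e x : V) : rankOne c e x = MulOpposite.op (inner ℍ[ℝ] e x) • c := rfl

theorem isCompactOperator_rankOne (c e : V) : IsCompactOperator (rankOne c e) :=
  isCompactOperator_of_finiteDimensional_factor (quaternionSMulRight c) (innerRight e)

end RightQuaternionicInnerProductSpace

section QuaternionicOperators

open RightQuaternionicInnerProductSpace

variable {V : Type*} [NormedAddCommGroup V] [Module ℍ[ℝ]ᵐᵒᵖ V]

theorem isWeylOp_iff_hasIndexZero (T : V →L[ℍ[ℝ]ᵐᵒᵖ] V) :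
    IsWeylOp T ↔ T.toLinearMap.HasIndexZero := by
  rw [IsWeylOp, IsFredholmOp, fredholmIndex, LinearMap.HasIndexZero, and_assoc, sub_eq_zero,
    Nat.cast_inj]

theorem toCalkin_eq_toCalkin_iff (S T : V →L[ℍ[ℝ]ᵐᵒᵖ] V) :
    toCalkin S = toCalkin T ↔ IsCompactOperator (S - T) := by
  rw [← mem_compactIdeal, ← TwoSidedIdeal.rel_iff]
  exact RingCon.eq _

variable [RightQuaternionicInnerProductSpace V]

/-- Real and quaternionic cokernels agree. -/
noncomputable def quotientRangeRestrictScalarsEquiv (T : V →L[ℍ[ℝ]ᵐᵒᵖ] V) :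
    (V ⧸ (T.restrictScalars ℝ).range) ≃ₗ[ℝ] (V ⧸ T.range) :=
  Submodule.Quotient.restrictScalarsEquiv ℝ T.range

theorem isFredholmOp_iff_real (T : V →L[ℍ[ℝ]ᵐᵒᵖ] V) :
    IsFredholmOp T ↔ FiniteDimensional ℝ (T.restrictScalars ℝ).ker ∧
      FiniteDimensional ℝ (V ⧸ (T.restrictScalars ℝ).range) := by
  rw [IsFredholmOp, ← finite_real_iff_finite_quaternion, ← finite_real_iff_finite_quaternion]
  exact and_congr Iff.rfl (Module.Finite.equiv_iff (quotientRangeRestrictScalarsEquiv T)).symm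

theorem isWeylOp_iff_real (T : V →L[ℍ[ℝ]ᵐᵒᵖ] V) :
    IsWeylOp T ↔ (T.restrictScalars ℝ).toLinearMap.HasIndexZero := by
  have h1 : Module.finrank ℝ (T.restrictScalars ℝ).ker = 4 * Module.finrank ℍ[ℝ]ᵐᵒᵖ T.ker :=
    finrank_real_eq_four_mul (W := T.ker)
  have h2 : Module.finrank ℝ (V ⧸ (T.restrictScalars ℝ).range)
      = 4 * Module.finrank ℍ[ℝ]ᵐᵒᵖ (V ⧸ T.range) := by
    rw [(quotientRangeRestrictScalarsEquiv T).finrank_eq, finrank_real_eq_four_mul]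
  rw [IsWeylOp, isFredholmOp_iff_real, fredholmIndex, LinearMap.HasIndexZero, and_assoc, h1, h2]
  refine and_congr Iff.rfl (and_congr Iff.rfl ?_)
  omega

theorem IsWeylOp.add_isCompactOperator [CompleteSpace V] {T K : V →L[ℍ[ℝ]ᵐᵒᵖ] V}
    (hT : IsWeylOp T) (hK : IsCompactOperator K) : IsWeylOp (T + K) := by
  rw [isWeylOp_iff_real] at hT ⊢
  have hK' : IsCompactOperator (K.restrictScalars ℝ) := hK
  exact HasIndexZero.add_isCompactOperator hT hK'

theorem isUnit_iff_bijective_quaternionic [CompleteSpace V] (T : V →L[ℍ[ℝ]ᵐᵒᵖ] V) :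
    IsUnit T ↔ Function.Bijective T := by
  constructor
  · rintro ⟨u, rfl⟩
    refine Function.bijective_iff_has_inverse.2 ⟨(↑u⁻¹ : V →L[ℍ[ℝ]ᵐᵒᵖ] V), fun x => ?_, fun x => ?_⟩
    · exact DFunLike.congr_fun u.inv_mul x
    · exact DFunLike.congr_fun u.mul_inv x
  · intro h
    let e := LinearEquiv.ofBijective T.toLinearMap h
    have hc : Continuous e.symm := (e.restrictScalars ℝ).continuous_symm T.continuous
    let S : V →L[ℍ[ℝ]ᵐᵒᵖ] V := ⟨e.symm, hc⟩
    refine ⟨⟨T, S, ?_, ?_⟩, rfl⟩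
    · ext x
      exact e.apply_symm_apply x
    · ext x
      exact e.symm_apply_apply x

theorem IsUnit.isWeylOp [CompleteSpace V] {T : V →L[ℍ[ℝ]ᵐᵒᵖ] V} (hT : IsUnit T) :
    IsWeylOp T := by
  rw [isWeylOp_iff_hasIndexZero]
  exact LinearMap.hasIndexZero_of_bijective ((isUnit_iff_bijective_quaternionic T).1 hT)

/-! ### Averaging a real-linear operator to a quaternionic linear one -/

/-- The quaternion `i`. -/
def unitI : ℍ[ℝ] := ⟨0, 1, 0, 0⟩

/-- The quaternion `j`. -/
def unitJ : ℍ[ℝ] := ⟨0, 0, 1, 0⟩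

/-- The quaternion `k`. -/
def unitK : ℍ[ℝ] := ⟨0, 0, 0, 1⟩

@[simp] theorem unitI_re : unitI.re = 0 := rfl

@[simp] theorem unitI_imI : unitI.imI = 1 := rfl

@[simp] theorem unitI_imJ : unitI.imJ = 0 := rfl

@[simp] theorem unitI_imK : unitI.imK = 0 := rfl

@[simp] theorem unitJ_re : unitJ.re = 0 := rfl

@[simp] theorem unitJ_imI : unitJ.imI = 0 := rfl

@[simp] theorem unitJ_imJ : unitJ.imJ = 1 := rfl

@[simp] theorem unitJ_imK : unitJ.imK = 0 := rfl

@[simp] theorem unitK_re : unitK.re = 0 := rfl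

@[simp] theorem unitK_imI : unitK.imI = 0 := rfl

@[simp] theorem unitK_imJ : unitK.imJ = 0 := rfl

@[simp] theorem unitK_imK : unitK.imK = 1 := rfl

theorem unitI_mul_unitI : unitI * unitI = -1 := by ext <;> simp

theorem unitJ_mul_unitJ : unitJ * unitJ = -1 := by ext <;> simp

theorem unitK_mul_unitK : unitK * unitK = -1 := by ext <;> simp

theorem unitI_mul_unitJ : unitI * unitJ = unitK := by ext <;> simp

theorem unitJ_mul_unitK : unitJ * unitK = unitI := by ext <;> simp

theorem unitK_mul_unitI : unitK * unitI = unitJ := by ext <;> simp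

theorem unitJ_mul_unitI : unitJ * unitI = -unitK := by ext <;> simp

theorem unitK_mul_unitJ : unitK * unitJ = -unitI := by ext <;> simp

theorem unitI_mul_unitK : unitI * unitK = -unitJ := by ext <;> simp

theorem Quaternion.eq_re_add_units (q : ℍ[ℝ]) :
    q = q.re • (1 : ℍ[ℝ]) + q.imI • unitI + q.imJ • unitJ + q.imK • unitK := by
  ext <;> simp

theorem rightMul_one (x : V) : rightMul 1 x = x := by simp [rightMul_apply]

theorem rightMul_neg (q : ℍ[ℝ]) (x : V) : rightMul (-q) x = -rightMul q x := by
  simp [rightMul_apply]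

theorem rightMul_add (p q : ℍ[ℝ]) (x : V) : rightMul (p + q) x = rightMul p x + rightMul q x := by
  simp [rightMul_apply, add_smul]

theorem rightMul_smul (r : ℝ) (q : ℍ[ℝ]) (x : V) : rightMul (r • q) x = r • rightMul q x := by
  simp [rightMul_apply]

theorem rightMul_rightMul (p q : ℍ[ℝ]) (x : V) :
    rightMul p (rightMul q x) = rightMul (q * p) x := by
  simp only [rightMul_apply, smul_smul, MulOpposite.op_mul]

/-- The sum of the conjugates of a real-linear operator by `1, i, j, k`. -/
noncomputable def conjSum (S : V →L[ℝ] V) : V →L[ℝ] V :=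
  S - rightMul unitI ∘L S ∘L rightMul unitI - rightMul unitJ ∘L S ∘L rightMul unitJ
    - rightMul unitK ∘L S ∘L rightMul unitK

theorem conjSum_apply (S : V →L[ℝ] V) (x : V) :
    conjSum S x = S x - rightMul unitI (S (rightMul unitI x))
      - rightMul unitJ (S (rightMul unitJ x)) - rightMul unitK (S (rightMul unitK x)) := rfl

theorem conjSum_rightMul (S : V →L[ℝ] V) (q : ℍ[ℝ]) (x : V) :
    conjSum S (rightMul q x) = rightMul q (conjSum S x) := by
  rw [Quaternion.eq_re_add_units q]
  simp only [rightMul_add, rightMul_smul, rightMul_one]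
  simp only [conjSum_apply, map_add, map_sub, map_smul, rightMul_rightMul, rightMul_one, unitI_mul_unitI, unitJ_mul_unitJ, unitK_mul_unitK,
    unitI_mul_unitJ, unitJ_mul_unitK, unitK_mul_unitI, unitJ_mul_unitI, unitK_mul_unitJ,
    unitI_mul_unitK, rightMul_neg, map_neg]
  module

/-- The average of the conjugates of a real-linear operator by `1, i, j, k`. -/
noncomputable def quaternionicAverage (S : V →L[ℝ] V) : V →L[ℍ[ℝ]ᵐᵒᵖ] V where
  toFun x := (1 / 4 : ℝ) • conjSum S x
  map_add' x y := by rw [map_add, smul_add]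
  map_smul' q x := by
    rw [← MulOpposite.op_unop q, ← rightMul_apply, conjSum_rightMul, rightMul_apply]
    exact (smul_comm _ _ _).symm
  cont := (conjSum S).continuous.const_smul (1 / 4 : ℝ)

theorem conjSum_comp_restrictScalars (S : V →L[ℝ] V) (T : V →L[ℍ[ℝ]ᵐᵒᵖ] V) (x : V) :
    conjSum (S ∘L T.restrictScalars ℝ) x = conjSum S (T x) := by
  simp only [conjSum_apply, ContinuousLinearMap.comp_apply,
    ContinuousLinearMap.coe_restrictScalars', rightMul_apply, map_smul]

theorem conjSum_restrictScalars_comp (S : V →L[ℝ] V) (T : V →L[ℍ[ℝ]ᵐᵒᵖ] V) (x : V) :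
    conjSum (T.restrictScalars ℝ ∘L S) x = T (conjSum S x) := by
  simp only [conjSum_apply, ContinuousLinearMap.comp_apply, map_sub,
    ContinuousLinearMap.coe_restrictScalars', rightMul_apply, map_smul]

theorem conjSum_one (x : V) : conjSum (1 : V →L[ℝ] V) x = (4 : ℝ) • x := by
  simp only [conjSum_apply, one_apply_eq_self, rightMul_rightMul, unitI_mul_unitI,
    unitJ_mul_unitJ, unitK_mul_unitK, rightMul_neg, rightMul_one]
  module

theorem conjSum_add (S T : V →L[ℝ] V) (x : V) :
    conjSum (S + T) x = conjSum S x + conjSum T x := by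
  simp only [conjSum_apply, add_apply, map_add]
  module

theorem isCompactOperator_quaternionicAverage {S : V →L[ℝ] V} (hS : IsCompactOperator S) :
    IsCompactOperator (quaternionicAverage S) := by
  have h (p q : ℍ[ℝ]) : IsCompactOperator (rightMul p ∘L S ∘L rightMul q : V →L[ℝ] V) :=
    (hS.comp_clm (rightMul q)).clm_comp (rightMul p)
  exact (((hS.sub (h unitI unitI)).sub (h unitJ unitJ)).sub (h unitK unitK)).smul (1 / 4 : ℝ)

theorem IsFredholmOp.exists_parametrix [CompleteSpace V] {T : V →L[ℍ[ℝ]ᵐᵒᵖ] V}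
    (hT : IsFredholmOp T) :
    ∃ S F G : V →L[ℍ[ℝ]ᵐᵒᵖ] V, IsCompactOperator F ∧ IsCompactOperator G ∧
      T * S + F = 1 ∧ S * T + G = 1 := by
  obtain ⟨hk, hr⟩ := (isFredholmOp_iff_real T).1 hT
  obtain ⟨P, hP⟩ := Submodule.ClosedComplemented.of_finiteDimensional (T.restrictScalars ℝ).ker
  obtain ⟨S, F, hF, h1, h2, -⟩ := _root_.exists_parametrix (T.restrictScalars ℝ) hr P hP
  let G : V →L[ℝ] V := (T.restrictScalars ℝ).ker.subtypeL ∘L P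
  have hG : IsCompactOperator G := isCompactOperator_of_finiteDimensional_factor _ _
  have h1' : T.restrictScalars ℝ ∘L S + F = 1 := by ext x; exact h1 x
  have h2' : S ∘L T.restrictScalars ℝ + G = 1 := by ext x; exact h2 x
  refine ⟨quaternionicAverage S, quaternionicAverage F, quaternionicAverage G,
    isCompactOperator_quaternionicAverage hF, isCompactOperator_quaternionicAverage hG, ?_, ?_⟩
  · ext x
    change T ((1 / 4 : ℝ) • conjSum S x) + (1 / 4 : ℝ) • conjSum F x = x
    rw [← ContinuousLinearMap.coe_restrictScalars' (R := ℝ) (f := T), map_smul,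
      ContinuousLinearMap.coe_restrictScalars', ← conjSum_restrictScalars_comp, ← smul_add,
      ← conjSum_add, h1', conjSum_one]
    module
  · ext x
    change (1 / 4 : ℝ) • conjSum S (T x) + (1 / 4 : ℝ) • conjSum G x = x
    rw [← conjSum_comp_restrictScalars, ← smul_add, ← conjSum_add, h2', conjSum_one]
    module

/-! ### Atkinson's theorem -/

theorem isUnit_toCalkin_iff [CompleteSpace V] (T : V →L[ℍ[ℝ]ᵐᵒᵖ] V) :
    IsUnit (toCalkin T) ↔ IsFredholmOp T := by
  constructor
  · rintro ⟨u, hu⟩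
    obtain ⟨S, hS⟩ := (compactIdeal V).ringCon.mk'_surjective (↑u⁻¹ : CalkinAlgebra V)
    have hS : toCalkin S = ↑u⁻¹ := hS
    have h1 : IsCompactOperator ((T * S - 1 : V →L[ℍ[ℝ]ᵐᵒᵖ] V).restrictScalars ℝ) := by
      refine (toCalkin_eq_toCalkin_iff _ _).1 ?_
      rw [toCalkin, toCalkin, map_mul, map_one, ← toCalkin, ← toCalkin, hS, ← hu, u.mul_inv]
    have h2 : IsCompactOperator ((S * T - 1 : V →L[ℍ[ℝ]ᵐᵒᵖ] V).restrictScalars ℝ) := by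
      refine (toCalkin_eq_toCalkin_iff _ _).1 ?_
      rw [toCalkin, toCalkin, map_mul, map_one, ← toCalkin, ← toCalkin, hS, ← hu, u.inv_mul]
    obtain ⟨-, h3, -⟩ := hasIndexZero_one_add h1
    have h4 := finiteDimensional_ker_one_add h2
    have e1 (x : V) : (1 + (T * S - 1 : V →L[ℍ[ℝ]ᵐᵒᵖ] V).restrictScalars ℝ) x = T (S x) :=
      add_sub_cancel x (T (S x))
    have e2 (x : V) : (1 + (S * T - 1 : V →L[ℍ[ℝ]ᵐᵒᵖ] V).restrictScalars ℝ) x = S (T x) :=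
      add_sub_cancel x (S (T x))
    rw [isFredholmOp_iff_real]
    constructor
    · refine Submodule.finiteDimensional_of_le (S₂ := LinearMap.ker
        (1 + (S * T - 1 : V →L[ℍ[ℝ]ᵐᵒᵖ] V).restrictScalars ℝ).toLinearMap) fun x hx => ?_
      have hx : T x = 0 := hx
      exact (e2 x).trans (by rw [hx, map_zero])
    · have hle : LinearMap.range (1 + (T * S - 1 : V →L[ℍ[ℝ]ᵐᵒᵖ] V).restrictScalars ℝ).toLinearMap
          ≤ (T.restrictScalars ℝ).range := by
        rintro _ ⟨x, rfl⟩
        exact ⟨S x, (e1 x).symm⟩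
      exact Module.Finite.of_surjective _ (Submodule.factor_surjective hle)
  · intro hT
    obtain ⟨S, F, G, hF, hG, h1, h2⟩ := hT.exists_parametrix
    have hzero {K : V →L[ℍ[ℝ]ᵐᵒᵖ] V} (hK : IsCompactOperator K) : toCalkin K = 0 := by
      have := (toCalkin_eq_toCalkin_iff K 0).2 (by simpa using hK)
      rwa [toCalkin, toCalkin, map_zero] at this
    refine ⟨⟨toCalkin T, toCalkin S, ?_, ?_⟩, rfl⟩
    · have := congrArg toCalkin h1
      rw [toCalkin, map_add, ← toCalkin, ← toCalkin, hzero hF, add_zero] at this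
      simpa [toCalkin] using this
    · have := congrArg toCalkin h2
      rw [toCalkin, map_add, ← toCalkin, ← toCalkin, hzero hG, add_zero] at this
      simpa [toCalkin] using this

end QuaternionicOperators

section WeylSpectrum

open RightQuaternionicInnerProductSpace

theorem Quaternion.exists_mul_eq_mul_star (q : ℍ[ℝ]) : ∃ p : ℍ[ℝ], p ≠ 0 ∧ q * p = p * star q := by
  by_cases h : q.imI = 0 ∧ q.imJ = 0
  · refine ⟨unitI, fun h => ?_, ?_⟩
    · simpa using congrArg QuaternionAlgebra.imI h
    · ext <;> simp [h.1, h.2]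
  · refine ⟨q.imJ • unitI - q.imI • unitJ, fun h0 => h ⟨?_, ?_⟩, ?_⟩
    · simpa using congrArg QuaternionAlgebra.imJ h0
    · simpa using congrArg QuaternionAlgebra.imI h0
    · ext <;> simp <;> ring

variable {V : Type*} [NormedAddCommGroup V] [Module ℍ[ℝ]ᵐᵒᵖ V]
  [RightQuaternionicInnerProductSpace V]

/-- The real-linear operator `x ↦ A x - x q`. -/
noncomputable def shift (q : ℍ[ℝ]) (A : V →L[ℍ[ℝ]ᵐᵒᵖ] V) : V →L[ℝ] V :=
  A.restrictScalars ℝ - rightMul q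

theorem shift_apply (q : ℍ[ℝ]) (A : V →L[ℍ[ℝ]ᵐᵒᵖ] V) (x : V) :
    shift q A x = A x - rightMul q x := rfl

theorem map_rightMul (A : V →L[ℍ[ℝ]ᵐᵒᵖ] V) (q : ℍ[ℝ]) (x : V) :
    A (rightMul q x) = rightMul q (A x) := map_smul A _ x

theorem pseudoResolvent_apply (q : ℍ[ℝ]) (A : V →L[ℍ[ℝ]ᵐᵒᵖ] V) (x : V) :
    pseudoResolvent q A x = A (A x) - (2 * q.re) • A x + (‖q‖ ^ 2) • x := by
  rw [pseudoResolvent, pow_two]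
  rfl

theorem shift_shift_star (q : ℍ[ℝ]) (A : V →L[ℍ[ℝ]ᵐᵒᵖ] V) (x : V) :
    shift q A (shift (star q) A x) = pseudoResolvent q A x := by
  have h1 : rightMul (star q) (A x) + rightMul q (A x) = (2 * q.re) • A x := by
    rw [← rightMul_add, Quaternion.star_add_self', real_smul_def, rightMul_apply]
  have h2 : rightMul (star q * q) x = (‖q‖ ^ 2) • x := by
    rw [Quaternion.star_mul_self, Quaternion.normSq_eq_norm_mul_self, ← pow_two, real_smul_def,
      rightMul_apply]
  rw [shift_apply, shift_apply, map_sub, map_sub, map_rightMul, rightMul_rightMul, h2,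
    pseudoResolvent_apply, ← h1]
  abel

theorem shift_star_shift (q : ℍ[ℝ]) (A : V →L[ℍ[ℝ]ᵐᵒᵖ] V) (x : V) :
    shift (star q) A (shift q A x) = pseudoResolvent q A x := by
  have h := shift_shift_star (star q) A x
  rw [star_star] at h
  rw [h, pseudoResolvent_apply, pseudoResolvent_apply, norm_star, Quaternion.re_star]

theorem shift_star_rightMul {p q : ℍ[ℝ]} (h : q * p = p * star q) (A : V →L[ℍ[ℝ]ᵐᵒᵖ] V) (x : V) :
    shift (star q) A (rightMul p x) = rightMul p (shift q A x) := by
  rw [shift_apply, shift_apply, map_rightMul, map_sub, rightMul_rightMul, rightMul_rightMul, h]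

theorem rightMul_inv_cancel {p : ℍ[ℝ]} (hp : p ≠ 0) (x : V) :
    rightMul p (rightMul p⁻¹ x) = x := by
  rw [rightMul_rightMul, inv_mul_cancel₀ hp, rightMul_one]

theorem rightMul_injective {p : ℍ[ℝ]} (hp : p ≠ 0) : Function.Injective (rightMul (V := V) p) := by
  refine Function.LeftInverse.injective (g := rightMul p⁻¹) fun x => ?_
  rw [rightMul_rightMul, mul_inv_cancel₀ hp, rightMul_one]

theorem pseudoResolvent_injective {q : ℍ[ℝ]} {A : V →L[ℍ[ℝ]ᵐᵒᵖ] V}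
    (h : Function.Injective (shift q A)) :
    Function.Injective (pseudoResolvent q A : V →L[ℍ[ℝ]ᵐᵒᵖ] V) := by
  obtain ⟨p, hp, hpq⟩ := Quaternion.exists_mul_eq_mul_star q
  have h' : Function.Injective (shift (star q) A) := by
    refine (injective_iff_map_eq_zero _).2 fun y hy => ?_
    rw [← rightMul_inv_cancel hp y, shift_star_rightMul hpq] at hy
    have := h ((rightMul_injective hp (hy.trans (map_zero _).symm)).trans (map_zero _).symm)
    rw [← rightMul_inv_cancel hp y, this, map_zero]
  intro x y hxy
  rw [← shift_shift_star, ← shift_shift_star] at hxy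
  exact h' (h hxy)

theorem pseudoResolvent_surjective {q : ℍ[ℝ]} {A : V →L[ℍ[ℝ]ᵐᵒᵖ] V}
    (h : Function.Surjective (shift q A)) :
    Function.Surjective (pseudoResolvent q A : V →L[ℍ[ℝ]ᵐᵒᵖ] V) := by
  obtain ⟨p, hp, hpq⟩ := Quaternion.exists_mul_eq_mul_star q
  intro y
  obtain ⟨z, rfl⟩ := h y
  obtain ⟨x, hx⟩ := h (rightMul p⁻¹ z)
  refine ⟨rightMul p x, ?_⟩
  rw [← shift_shift_star, shift_star_rightMul hpq, hx, rightMul_inv_cancel hp]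

theorem isCompactOperator_pseudoResolvent_add_sub (q : ℍ[ℝ]) (A : V →L[ℍ[ℝ]ᵐᵒᵖ] V)
    {K : V →L[ℍ[ℝ]ᵐᵒᵖ] V} (hK : IsCompactOperator K) :
    IsCompactOperator (pseudoResolvent q (A + K) - pseudoResolvent q A) := by
  have h : pseudoResolvent q (A + K) - pseudoResolvent q A
      = A * K + K * (A + K) - (2 * q.re) • K := by
    simp only [pseudoResolvent, smul_add]
    noncomm_ring
  rw [h]
  have h1 : IsCompactOperator (A * K) := hK.clm_comp A
  have h2 : IsCompactOperator (K * (A + K)) := hK.comp_clm (A + K)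
  exact (h1.add h2).sub (hK.smul (2 * q.re))

variable [CompleteSpace V]

theorem isWeylOp_pseudoResolvent_add_iff (q : ℍ[ℝ]) (A : V →L[ℍ[ℝ]ᵐᵒᵖ] V)
    {K : V →L[ℍ[ℝ]ᵐᵒᵖ] V} (hK : IsCompactOperator K) :
    IsWeylOp (pseudoResolvent q (A + K)) ↔ IsWeylOp (pseudoResolvent q A) := by
  have h := isCompactOperator_pseudoResolvent_add_sub q A hK
  constructor <;> intro hT
  · have h' : IsCompactOperator (-(pseudoResolvent q (A + K) - pseudoResolvent q A)) := h.neg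
    simpa using hT.add_isCompactOperator h'
  · simpa using hT.add_isCompactOperator h

theorem IsWeylOp.isUnit_of_injective {T : V →L[ℍ[ℝ]ᵐᵒᵖ] V} (hT : IsWeylOp T)
    (h : Function.Injective T) : IsUnit T :=
  (isUnit_iff_bijective_quaternionic T).2
    (((isWeylOp_iff_hasIndexZero T).1 hT).bijective_of_injective h)

theorem IsWeylOp.isUnit_of_surjective {T : V →L[ℍ[ℝ]ᵐᵒᵖ] V} (hT : IsWeylOp T)
    (h : Function.Surjective T) : IsUnit T :=
  (isUnit_iff_bijective_quaternionic T).2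
    (((isWeylOp_iff_hasIndexZero T).1 hT).bijective_of_surjective h)

theorem exists_isCompactOperator_finrank_ker_shift_lt {q : ℍ[ℝ]} {A : V →L[ℍ[ℝ]ᵐᵒᵖ] V}
    (hA : IsFredholmOp (pseudoResolvent q A)) (hinj : ¬ Function.Injective (shift q A))
    (hsurj : ¬ Function.Surjective (shift q A)) :
    ∃ K : V →L[ℍ[ℝ]ᵐᵒᵖ] V, IsCompactOperator K ∧
      Module.finrank ℝ (shift q (A + K)).ker < Module.finrank ℝ (shift q A).ker := by
  let _ := realInnerProductSpace V
  obtain ⟨hk, hr⟩ := (isFredholmOp_iff_real _).1 hA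
  have hk' : FiniteDimensional ℝ (shift q A).ker := by
    refine Submodule.finiteDimensional_of_le
      (S₂ := ((pseudoResolvent q A).restrictScalars ℝ).ker) fun x hx => ?_
    have hx : shift q A x = 0 := hx
    change pseudoResolvent q A x = 0
    rw [← shift_star_shift, hx, map_zero]
  have hr' : FiniteDimensional ℝ (V ⧸ (shift q A).range) := by
    have hle : ((pseudoResolvent q A).restrictScalars ℝ).range ≤ (shift q A).range := by
      rintro _ ⟨x, rfl⟩
      exact ⟨shift (star q) A x, shift_shift_star q A x⟩
    exact Module.Finite.of_surjective _ (Submodule.factor_surjective hle)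
  obtain ⟨e, he, he0⟩ : ∃ e, shift q A e = 0 ∧ e ≠ 0 := by
    by_contra! h
    exact hinj ((injective_iff_map_eq_zero _).2 h)
  obtain ⟨c, hc, hc0⟩ : ∃ c ∈ (shift q A).rangeᗮ, c ≠ 0 := by
    refine (Submodule.ne_bot_iff _).1 fun h => hsurj ?_
    have : CompleteSpace (shift q A).range :=
      (isClosed_range_of_finiteDimensional _ hk' hr').completeSpace_coe
    exact LinearMap.range_eq_top.1 ((Submodule.orthogonal_eq_bot_iff).1 h)
  have hc' (x : V) : inner ℝ c (shift q A x) = 0 :=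
    Submodule.inner_left_of_mem_orthogonal (LinearMap.mem_range_self _ x) hc
  have hK (x : V) : inner ℝ c ((rankOne c e).restrictScalars ℝ x) = ‖c‖ ^ 2 * inner ℝ e x := by
    change (inner ℍ[ℝ] c (rankOne c e x)).re = ‖c‖ ^ 2 * (inner ℍ[ℝ] e x).re
    rw [rankOne_apply, RightQuaternionicInnerProductSpace.inner_smul_right, inner_self, Quaternion.coe_mul_eq_smul]
    rfl
  obtain ⟨t, ht⟩ := exists_finrank_ker_add_smul_lt (shift q A) ((rankOne c e).restrictScalars ℝ)
    hk' hr' he he0 hc' (pow_ne_zero 2 (norm_ne_zero_iff.2 hc0)) hK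
  refine ⟨t • rankOne c e, (isCompactOperator_rankOne c e).smul t, ?_⟩
  have h : shift q (A + t • rankOne c e)
      = shift q A + t • (rankOne c e).restrictScalars ℝ := by
    ext x
    change A x + t • rankOne c e x - rightMul q x = A x - rightMul q x + t • rankOne c e x
    abel
  rw [h]
  exact ht

theorem IsWeylOp.exists_isUnit_pseudoResolvent_add {q : ℍ[ℝ]} {A : V →L[ℍ[ℝ]ᵐᵒᵖ] V}
    (hA : IsWeylOp (pseudoResolvent q A)) :
    ∃ K : V →L[ℍ[ℝ]ᵐᵒᵖ] V, IsCompactOperator K ∧ IsUnit (pseudoResolvent q (A + K)) := by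
  induction hn : Module.finrank ℝ (shift q A).ker using Nat.strong_induction_on generalizing A with
  | _ n ih =>
    have hzero : IsCompactOperator (0 : V →L[ℍ[ℝ]ᵐᵒᵖ] V) := isCompactOperator_zero
    by_cases hinj : Function.Injective (shift q A)
    · exact ⟨0, hzero, by
        rw [add_zero]; exact hA.isUnit_of_injective (pseudoResolvent_injective hinj)⟩
    by_cases hsurj : Function.Surjective (shift q A)
    · exact ⟨0, hzero, by
        rw [add_zero]; exact hA.isUnit_of_surjective (pseudoResolvent_surjective hsurj)⟩
    obtain ⟨K, hK, hlt⟩ := exists_isCompactOperator_finrank_ker_shift_lt hA.1 hinj hsurj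
    obtain ⟨K', hK', hu⟩ := ih _ (hn ▸ hlt) ((isWeylOp_pseudoResolvent_add_iff q A hK).2 hA) rfl
    exact ⟨K + K', hK.add hK', by rwa [← add_assoc]⟩

theorem mem_weylSSpectrum_iff (q : ℍ[ℝ]) (A : V →L[ℍ[ℝ]ᵐᵒᵖ] V) :
    q ∈ weylSSpectrum A ↔ ¬ IsWeylOp (pseudoResolvent q A) := by
  simp only [weylSSpectrum, sSpectrum, Set.mem_iInter, Set.mem_ofPred_eq]
  constructor
  · intro h hA
    obtain ⟨K, hK, hu⟩ := hA.exists_isUnit_pseudoResolvent_add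
    exact h K hK hu
  · intro h K hK hu
    exact h ((isWeylOp_pseudoResolvent_add_iff q A hK).1 hu.isWeylOp)

theorem mem_essentialSSpectrum_iff (q : ℍ[ℝ]) (A : V →L[ℍ[ℝ]ᵐᵒᵖ] V) :
    q ∈ essentialSSpectrum A ↔ ¬ IsFredholmOp (pseudoResolvent q A) := by
  have h : pseudoResolvent q (toCalkin A) = toCalkin (pseudoResolvent q A) := rfl
  rw [essentialSSpectrum, sSpectrum, Set.mem_ofPred_eq, h, isUnit_toCalkin_iff]

theorem mem_essential_union_index_iff (q : ℍ[ℝ]) (A : V →L[ℍ[ℝ]ᵐᵒᵖ] V) :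
    q ∈ essentialSSpectrum A ∪ (⋃ (k : ℤ) (_ : k ≠ 0), indexSSpectrum k A) ↔
      ¬ IsWeylOp (pseudoResolvent q A) := by
  simp only [Set.mem_union, mem_essentialSSpectrum_iff, Set.mem_iUnion, indexSSpectrum,
    Set.mem_ofPred_eq, IsWeylOp, exists_prop]
  constructor
  · rintro (h | ⟨k, hk, -, h⟩) ⟨hF, hi⟩
    · exact h hF
    · exact hk (h.symm.trans hi)
  · intro h
    by_cases hF : IsFredholmOp (pseudoResolvent q A)
    · exact Or.inr ⟨_, fun hi => h ⟨hF, hi⟩, hF, rfl⟩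
    · exact Or.inl hF

theorem mem_sSpectrum_diff_iff (q : ℍ[ℝ]) (A : V →L[ℍ[ℝ]ᵐᵒᵖ] V) :
    q ∈ sSpectrum A \ indexZeroSSpectrum A ↔ ¬ IsWeylOp (pseudoResolvent q A) := by
  simp only [Set.mem_sdiff, indexZeroSSpectrum, sSpectrum, Set.mem_ofPred_eq]
  exact ⟨fun h hA => h.2 ⟨h.1, hA⟩, fun h => ⟨fun hu => h hu.isWeylOp, fun h' => h h'.2⟩⟩

end WeylSpectrum

theorem theorem6p5 (V : Type*) [NormedAddCommGroup V] [Module ℍ[ℝ]ᵐᵒᵖ V]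
    [RightQuaternionicInnerProductSpace V] [CompleteSpace V]
    [TopologicalSpace.SeparableSpace V] (A : V →L[ℍ[ℝ]ᵐᵒᵖ] V) :
    weylSSpectrum A =
        essentialSSpectrum A ∪ (⋃ (k : ℤ) (_ : k ≠ 0), indexSSpectrum k A) ∧
      essentialSSpectrum A ∪ (⋃ (k : ℤ) (_ : k ≠ 0), indexSSpectrum k A) =
        sSpectrum A \ indexZeroSSpectrum A := by
  constructor <;> ext q
  · rw [mem_weylSSpectrum_iff, mem_essential_union_index_iff]
  · rw [mem_essential_union_index_iff, mem_sSpectrum_diff_iff]
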